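/- Let $\varpi_1,\varpi_2$ be the fundamental weights of type $C_2$ (for $Sp(4,\mathbb C)$), with simple roots $\alpha_1=2\varpi_1-\varpi_2$ (short) and $\alpha_2=-2\varpi_1+2\varpi_2$ (long). For a dominant weight $\lambda=\lambda_1\varpi_1+\lambda_2\varpi_2$ let $\mathcal B(\lambda)$ be the crystal of Kashiwara–Nakashima (KN) tableaux of type $C_2$ with $\lambda_2$ columns of length two and $\lambda_1$ columns of length one, in the alphabet $1<2<\bar 2<\bar 1$. Its crystal operators $e_i,f_i$ ($i=1,2$) are given by the signature rule on the word of a tableau, obtained by reading the columns from right to left and each column from top to bottom, where each label $+$ is cancelled with the first free $-$ to its right. Let $\phi_i(T)=\max\{a\ge 0: f_i^a(T)\neq 0\}$. Let $s_i$ be the reflection of $i$-strings, let $f_{12}:=s_1f_2s_1$, and let $\phi_{12}(T)=\max\{a\ge 0: f_{12}^a(T)\ne 0\}$. Put $$Z(T)=\phi_1(T)+\phi_2(T)+\phi_{12}(T).$$ Let $\Phi:\mathcal B(\lambda)\to\mathcal B(\lambda+2\varpi_1)$ be the embedding that puts a $1$ in front of the first row of a tableau and a $\bar 1$ at the end of that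 row, leaves the second row in place, and then replaces the column with entries $1,\bar 1$, if there is one, by the column with entries $2,\bar 2$. For $T\in\mathcal B(\lambda)$ the preatomic number $\operatorname{pat}(T)$ is the maximal integer $p\geq 0$ with $2p\le\lambda_1$ such that $T$ lies in the image of $\Phi^{p}:\mathcal B(\lambda-2p\varpi_1)\to\mathcal B(\lambda)$. Equivalently, $T$ lies in the preatom $\mathcal P(\lambda')\subset\mathcal B(\lambda)$ with $\lambda'=\lambda-2\operatorname{pat}(T)\varpi_1$, i.e. in the image under $\Phi^{\operatorname{pat}(T)}$ of the principal preatom $\mathcal P(\lambda')$, which is the complement of $\Phi(\mathcal B(\lambda'-2\varpi_1))$ in $\mathcal B(\lambda')$ if $\lambda'_1\ge 2$, and all of $\mathcal B(\lambda')$ if $\lambda'_1\le 1$. **Proposition.** Let $T\in\mathcal B(\lambda)$ have weight $\mu=\mu_1\varpi_1+\mu_2\varpi_2$, and let $\lambda'=\lambda-2\operatorname{pat}(T)\varpi_1$, so that $T\in\mathcal P(\lambda')\subset\mathcal B(\lambda)$. Then $$Z(T)=\lambda'_1+\lambda'_2+\mu_1+\mu_2+\max\left(0,\frac{|\mu_1|-\lambda'_1}{2}\right)+\operatorname{pat}(T),$$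 where $\lambda'_1=\lambda_1-2\operatorname{pat}(T)$ and $\lambda'_2=\lambda_2$. -/

import Mathlib

namespace C2

/-- The alphabet `1 < 2 < 2̄ < 1̄` of Kashiwara–Nakashima tableaux of type `C₂`. -/
inductive Letter
  | one
  | two
  | twoBar
  | oneBar
  deriving DecidableEq

namespace Letter

/-- Position of a letter in the alphabet. -/
def rank : Letter → ℕ
  | one => 0
  | two => 1
  | twoBar => 2
  | oneBar => 3

theorem rank_injective : Function.Injective rank := by
  intro x y h
  cases x <;> cases y <;> simp [rank] at h ⊢

instance : LinearOrder Letter := LinearOrder.lift' rank rank_injective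

end Letter

/-- The nodes of the Dynkin diagram: `node1` is the short simple root `α₁ = 2ϖ₁ - ϖ₂`, and
`node2` is the long simple root `α₂ = -2ϖ₁ + 2ϖ₂`. -/
inductive Node
  | node1
  | node2
  deriving DecidableEq

open Letter Node

/-! ### Crystal operators on words -/

/-- The two labels used in signatures. -/
inductive Label
  | plus
  | minus
  deriving DecidableEq

/-- The label of a letter. For `i = 1` the letters `1, 2̄` are labelled `+` and `2, 1̄` are labelled
`-`; for `i = 2` the letter `2` is labelled `+` and `2̄` is labelled `-`. -/
def label : Node → Letter → Option Label
  | node1, one => some .plus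
  | node1, two => some .minus
  | node1, twoBar => some .plus
  | node1, oneBar => some .minus
  | node2, one => none
  | node2, two => some .plus
  | node2, twoBar => some .minus
  | node2, oneBar => none

/-- The arrows of the crystal of the vector representation: `1 → 2 → 2̄ → 1̄`, coloured `1, 2, 1`
(meaningful on letters labelled `+`). -/
def lower : Node → Letter → Letter
  | node1, one => two
  | node1, twoBar => oneBar
  | node2, two => twoBar
  | _, x => x

/-- The reversed arrows (meaningful on letters labelled `-`). -/
def raise : Node → Letter → Letter
  | node1, two => one
  | node1, oneBar => twoBar
  | node2, twoBar => two
  | _, x => x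

/-- The `i`-signature `(-)^r (+)^s` of a word, recorded as `(r, s)`. It is what remains of the labels
after cancelling each `+` with the first free `-` to its right. Reading the word from its right
end: a `+` put in front of `(-)^(r+1) (+)^s` cancels the first `-`, and a `+` put in front of
`(+)^s` survives. -/
def signature (i : Node) : List Letter → ℕ × ℕ
  | [] => (0, 0)
  | x :: w =>
    match label i x, signature i w with
    | some .plus, (0, s) => (0, s + 1)
    | some .plus, (r + 1, s) => (r, s)
    | some .minus, (r, s) => (r + 1, s)
    | none, (r, s) => (r, s)

/-- The crystal operator `f_i`: it changes the letter that carries the left-most surviving `+` along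
the arrow coloured `i`, and is undefined (`none`) if there is no such letter. The first letter of
`x :: w` carries a surviving `+` exactly if it is labelled `+` and no `-` survives in `w`. -/
def f (i : Node) : List Letter → Option (List Letter)
  | [] => none
  | x :: w =>
    if label i x = some .plus ∧ (signature i w).1 = 0 then some (lower i x :: w)
    else (f i w).map (fun w' => x :: w')

/-- The crystal operator `e_i`: it changes the letter that carries the right-most surviving `-` along
the reversed arrow coloured `i`, and is undefined (`none`) if there is no such letter. If no `-`
survives in `w`, the only candidate in `x :: w` is `x`; if exactly one survives in `w` and `x` is
labelled `+`, these two cancel. -/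
def e (i : Node) : List Letter → Option (List Letter)
  | [] => none
  | x :: w =>
    if (signature i w).1 = 0 then
      (if label i x = some .minus then some (raise i x :: w) else none)
    else if label i x = some .plus ∧ (signature i w).1 = 1 then none
    else (e i w).map (fun w' => x :: w')

/-- The `a`-fold iterate of a partial operator. -/
def iter (g : List Letter → Option (List Letter)) : ℕ → List Letter → Option (List Letter)
  | 0, w => some w
  | a + 1, w => (g w).bind (iter g a)

/-- `max {a : g^a (w) ≠ 0}`. -/
noncomputable def stringLength (g : List Letter → Option (List Letter)) (w : List Letter) : ℕ :=
  sSup {a : ℕ | iter g a w ≠ none}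

/-- `φ_i(w) = max {a : f_i^a (w) ≠ 0}`. -/
noncomputable def phi (i : Node) (w : List Letter) : ℕ := stringLength (f i) w

/-- `ε_i(w) = max {a : e_i^a (w) ≠ 0}`. -/
noncomputable def eps (i : Node) (w : List Letter) : ℕ := stringLength (e i) w

/-- The simple reflection `s_i`, which reverses the `i`-string: `e_i^(ε_i - φ_i)` if `φ_i ≤ ε_i`, and
`f_i^(φ_i - ε_i)` otherwise. These iterates are always defined (`reflect_some` below). -/
noncomputable def reflect (i : Node) (w : List Letter) : List Letter :=
  (if phi i w ≤ eps i w then iter (e i) (eps i w - phi i w) w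
    else iter (f i) (phi i w - eps i w) w).getD w

/-- The modified crystal operator `f₁₂ = s₁ f₂ s₁`. -/
noncomputable def f12 (w : List Letter) : Option (List Letter) :=
  (f node2 (reflect node1 w)).map (reflect node1)

/-- `φ₁₂(w) = max {a : f₁₂^a (w) ≠ 0}`. -/
noncomputable def phi12 (w : List Letter) : ℕ := stringLength f12 w

/-! #### The maxima above exist and are read off from the signature -/

theorem f_some {i : Node} {w w' : List Letter} (h : f i w = some w') :
    (signature i w').1 = (signature i w).1 + 1 ∧ (signature i w').2 + 1 = (signature i w).2 := by
  induction w generalizing w' with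
  | nil => simp [f] at h
  | cons x w ih =>
    rw [f] at h
    split_ifs at h with hc
    · obtain ⟨hx, hr⟩ := hc
      obtain rfl := Option.some.inj h
      rcases hs : signature i w with ⟨r, s⟩
      rw [hs] at hr
      simp only at hr
      subst hr
      cases i <;> cases x <;> simp_all [label, signature, lower]
    · obtain ⟨u, hu, rfl⟩ := Option.map_eq_some_iff.mp h
      have := ih hu
      rcases hs : signature i w with ⟨r, s⟩
      rcases hs' : signature i u with ⟨r', s'⟩
      rw [hs, hs'] at this
      rw [hs] at hc
      rcases r with _ | r <;> rcases r' with _ | r' <;> cases i <;> cases x <;>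
        simp_all [label, signature]

theorem f_eq_none_iff {i : Node} {w : List Letter} : f i w = none ↔ (signature i w).2 = 0 := by
  induction w with
  | nil => simp [f, signature]
  | cons x w ih =>
    rw [f]
    rcases hs : signature i w with ⟨r, s⟩
    rw [hs] at ih
    rcases r with _ | r <;> cases i <;> cases x <;> simp_all [label, signature]

theorem e_some {i : Node} {w w' : List Letter} (h : e i w = some w') :
    (signature i w').1 + 1 = (signature i w).1 ∧ (signature i w').2 = (signature i w).2 + 1 := by
  induction w generalizing w' with
  | nil => simp [e] at h
  | cons x w ih =>
    rw [e] at h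
    rcases hs : signature i w with ⟨r, s⟩
    rw [hs] at h ih
    rcases r with _ | r
    · cases i <;> cases x <;> simp_all [label, signature, raise] <;> subst h <;>
        simp_all [label, signature]
    · rw [if_neg (by simp)] at h
      split_ifs at h with h1
      · obtain ⟨u, hu, rfl⟩ := Option.map_eq_some_iff.mp h
        have := ih hu
        rcases hs' : signature i u with ⟨r', s'⟩
        rw [hs'] at this
        obtain ⟨h2, h3⟩ := this
        simp only at h2 h3
        obtain rfl : r = r' := by omega
        subst h3
        rcases r with _ | r <;> cases i <;> cases x <;> simp_all [label, signature]

theorem e_eq_none_iff {i : Node} {w : List Letter} : e i w = none ↔ (signature i w).1 = 0 := by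
  induction w with
  | nil => simp [e, signature]
  | cons x w ih =>
    rw [e]
    rcases hs : signature i w with ⟨r, s⟩
    rw [hs] at ih
    rcases r with _ | _ | r <;> cases i <;> cases x <;> simp_all [label, signature]

theorem iter_f_ne_none_iff {i : Node} {a : ℕ} {w : List Letter} :
    iter (f i) a w ≠ none ↔ a ≤ (signature i w).2 := by
  induction a generalizing w with
  | zero => simp [iter]
  | succ a ih =>
    rcases h : f i w with _ | u
    · have := f_eq_none_iff.mp h
      simp [iter, h, this]
    · have := f_some h
      simp only [iter, h, Option.bind_some]
      rw [ih]
      omega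

theorem iter_e_ne_none_iff {i : Node} {a : ℕ} {w : List Letter} :
    iter (e i) a w ≠ none ↔ a ≤ (signature i w).1 := by
  induction a generalizing w with
  | zero => simp [iter]
  | succ a ih =>
    rcases h : e i w with _ | u
    · have := e_eq_none_iff.mp h
      simp [iter, h, this]
    · have := e_some h
      simp only [iter, h, Option.bind_some]
      rw [ih]
      omega

theorem isGreatest_signature_snd (i : Node) (w : List Letter) :
    IsGreatest {a : ℕ | iter (f i) a w ≠ none} (signature i w).2 :=
  ⟨iter_f_ne_none_iff.mpr le_rfl, fun _ h => iter_f_ne_none_iff.mp h⟩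

theorem isGreatest_signature_fst (i : Node) (w : List Letter) :
    IsGreatest {a : ℕ | iter (e i) a w ≠ none} (signature i w).1 :=
  ⟨iter_e_ne_none_iff.mpr le_rfl, fun _ h => iter_e_ne_none_iff.mp h⟩

theorem phi_eq (i : Node) (w : List Letter) : phi i w = (signature i w).2 :=
  (isGreatest_signature_snd i w).csSup_eq

theorem eps_eq (i : Node) (w : List Letter) : eps i w = (signature i w).1 :=
  (isGreatest_signature_fst i w).csSup_eq

theorem reflect_some (i : Node) (w : List Letter) :
    some (reflect i w) = if phi i w ≤ eps i w then iter (e i) (eps i w - phi i w) w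
      else iter (f i) (phi i w - eps i w) w := by
  unfold reflect
  split_ifs with h
  · have : iter (e i) (eps i w - phi i w) w ≠ none :=
      iter_e_ne_none_iff.mpr (by rw [← eps_eq]; omega)
    obtain ⟨u, hu⟩ := Option.ne_none_iff_exists'.mp this
    simp [hu]
  · have : iter (f i) (phi i w - eps i w) w ≠ none :=
      iter_f_ne_none_iff.mpr (by rw [← phi_eq]; omega)
    obtain ⟨u, hu⟩ := Option.ne_none_iff_exists'.mp this
    simp [hu]

/-! ### Kashiwara–Nakashima tableaux of type `C₂` -/

/-- A filling of a shape with at most two rows: `cols` lists, from left to right, the columns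
`(top, bottom)` of length two, and `tail` lists the columns of length one that follow them. -/
structure Tableau where
  cols : List (Letter × Letter)
  tail : List Letter

namespace Tableau

/-- The first row. -/
def topRow (T : Tableau) : List Letter := T.cols.map Prod.fst ++ T.tail

/-- The second row. -/
def bottomRow (T : Tableau) : List Letter := T.cols.map Prod.snd

/-- The filling with given rows. -/
def ofRows (top bottom : List Letter) : Tableau := ⟨top.zip bottom, top.drop bottom.length⟩

/-- Rows increase weakly and columns increase strictly. -/
def IsSemistandard (T : Tableau) : Prop :=
  T.topRow.Pairwise (· ≤ ·) ∧ T.bottomRow.Pairwise (· ≤ ·) ∧ ∀ c ∈ T.cols, c.1 < c.2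

/-- The split of each column. A column that does not contain both `z` and `z̄` for some `z` is
doubled. The column `2, 2̄` (with `z = 2`, `t = 1`) splits into `1, 2̄` and `2, 1̄`. -/
def splitCol (c : Letter × Letter) : List (Letter × Letter) :=
  if c = (two, twoBar) then [(one, twoBar), (two, oneBar)] else [c, c]

/-- The splitting: the concatenation of the splits of the columns. -/
def split (T : Tableau) : Tableau :=
  ⟨T.cols.flatMap splitCol, T.tail.flatMap (fun x => [x, x])⟩

/-- Kashiwara–Nakashima tableaux: semistandard, with admissible columns (for `n = 2` the only strictly
increasing column that is not admissible is `1, 1̄`, as there is no letter `t < 1`), and with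
semistandard splitting. -/
def IsKN (T : Tableau) : Prop :=
  T.IsSemistandard ∧ (∀ c ∈ T.cols, c ≠ (one, oneBar)) ∧ T.split.IsSemistandard

/-- The word: columns from right to left, each column from top to bottom. -/
def word (T : Tableau) : List Letter :=
  T.tail.reverse ++ T.cols.reverse.flatMap (fun c => [c.1, c.2])

/-- `n_x(T)`, the number of entries equal to `x`. -/
def num (T : Tableau) (x : Letter) : ℤ := ((T.topRow ++ T.bottomRow).count x : ℤ)

/-- The coefficient of `ϖ₁` in the weight of `T`. -/
def wt1 (T : Tableau) : ℤ := (T.num one - T.num oneBar) - (T.num two - T.num twoBar)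

/-- The coefficient of `ϖ₂` in the weight of `T`. -/
def wt2 (T : Tableau) : ℤ := T.num two - T.num twoBar

end Tableau

open Tableau

/-- The crystal `B(λ)` for `λ = l1 ϖ₁ + l2 ϖ₂`: the KN tableaux with `l2` columns of length two and
`l1` columns of length one. -/
def crystal (l1 l2 : ℕ) : Set Tableau :=
  {T | T.IsKN ∧ T.cols.length = l2 ∧ T.tail.length = l1}

/-- The embedding `Φ : B(λ) → B(λ + 2ϖ₁)`: put a `1` in front of the first row and a `1̄` at its end,
and then replace every column `1, 1̄` by `2, 2̄`. -/
def embed (T : Tableau) : Tableau :=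
  let T' := ofRows (one :: (T.topRow ++ [oneBar])) T.bottomRow
  ⟨T'.cols.map (fun c => if c = (one, oneBar) then (two, twoBar) else c), T'.tail⟩

/-- The principal preatom `P(λ) ⊆ B(λ)`: the complement of `Φ(B(λ - 2ϖ₁))` if `l1 ≥ 2`, and all of
`B(λ)` if `l1 ≤ 1`. -/
def principalPreatom (l1 l2 : ℕ) : Set Tableau :=
  if 2 ≤ l1 then crystal l1 l2 \ embed '' crystal (l1 - 2) l2 else crystal l1 l2

/-- The preatomic number of `T ∈ B(λ)`: the maximal `p` such that `T` lies in the image of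
`Φ^p : B(λ - 2pϖ₁) → B(λ)`. -/
noncomputable def preatomicNumber (l1 l2 : ℕ) (T : Tableau) : ℕ :=
  sSup {p : ℕ | 2 * p ≤ l1 ∧ T ∈ embed^[p] '' crystal (l1 - 2 * p) l2}

/-- The maximum in the definition of the preatomic number exists. -/
theorem preatomicNumber_isGreatest {l1 l2 : ℕ} {T : Tableau} (hT : T ∈ crystal l1 l2) :
    IsGreatest {p : ℕ | 2 * p ≤ l1 ∧ T ∈ embed^[p] '' crystal (l1 - 2 * p) l2}
      (preatomicNumber l1 l2 T) := by
  have hb : BddAbove {p : ℕ | 2 * p ≤ l1 ∧ T ∈ embed^[p] '' crystal (l1 - 2 * p) l2} :=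
    ⟨l1, fun p hp => by have := hp.1; omega⟩
  have hn : {p : ℕ | 2 * p ≤ l1 ∧ T ∈ embed^[p] '' crystal (l1 - 2 * p) l2}.Nonempty :=
    ⟨0, by simp, by simpa using hT⟩
  exact ⟨Nat.sSup_mem hn hb, fun p hp => le_csSup hb hp⟩

/-- With `p` the preatomic number of `T ∈ B(λ)`, the tableau `T` lies in the preatom
`P(λ - 2pϖ₁) ⊆ B(λ)`, embedded by `Φ^p`. -/
theorem mem_preatom {l1 l2 : ℕ} {T : Tableau} (hT : T ∈ crystal l1 l2) :
    2 * preatomicNumber l1 l2 T ≤ l1 ∧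
      T ∈ embed^[preatomicNumber l1 l2 T] ''
        principalPreatom (l1 - 2 * preatomicNumber l1 l2 T) l2 := by
  obtain ⟨⟨hp, U, hU, hUT⟩, hmax⟩ := preatomicNumber_isGreatest hT
  refine ⟨hp, U, ?_, hUT⟩
  unfold principalPreatom
  split_ifs with h2
  · refine ⟨hU, ?_⟩
    rintro ⟨V, hV, rfl⟩
    have := hmax (a := preatomicNumber l1 l2 T + 1)
      ⟨by omega, V, by convert hV using 2; omega, by rw [Function.iterate_succ_apply, hUT]⟩
    omega
  · exact hU

/-- `Z(T) = φ₁(T) + φ₂(T) + φ₁₂(T)`. -/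
noncomputable def Z (T : Tableau) : ℕ :=
  phi node1 T.word + phi node2 T.word + phi12 T.word

end C2

namespace C2

open Letter Node Tableau

/-! ### The crystal operators are partially inverse to each other -/

/-! A KN tableau of type `C₂` is determined by multiplicities (`exists_eq_blockTableau`): its tail
is `1^s 2^r 2̄^q 1̄^p`, its columns are `(12)^b (12̄)^d (22̄)^e (21̄)^c (2̄1̄)^a`, and the splitting
condition forces `e ≤ 1`. Put `m = 2c + e` and `n = 2d + e`, the numbers of columns `21̄` and `12̄`
in the splitting. For node 1 the word behaves like a tensor product of three blocks with signatures
`-^p +^q`, `-^r +^s`, `-^m +^n`; the pairs `2̄1̄` and `12` are inert. Hence `s₁` changes `x`, `y`,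
`z` letters in the three blocks, where `f₁` exhausts the blocks from the left and `e₁` from the
right. As `f₁₂` is conjugate to `f₂` under the involution `s₁`, `φ₁₂` is `φ₂` of the reflected word,
and `Z` becomes an explicit function of the multiplicities, piecewise linear up to the parities of
`m` and `n`.

Two facts then suffice. The embedding `Φ` keeps the weight and raises `Z` by one (`embed_spec`):
`φ₁` grows by one, while `φ₂` and `φ₁₂` stay. Outside the image of `Φ`, one of seven triples of
multiplicities vanishes (`cases_of_not_embed`), and in each of these families the formula with `pat
= 0` can be checked directly (`wordZ_of_not_embed`). Writing `T = Φ^p(U)` with `U` in a principal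
preatom combines the two. -/

theorem e_of_f {i : Node} {w w' : List Letter} (h : f i w = some w') : e i w' = some w := by
  induction w generalizing w' with
  | nil => simp [f] at h
  | cons x w ih =>
    rw [f] at h
    split_ifs at h with hc
    · obtain ⟨hx, hr⟩ := hc
      obtain rfl := Option.some.inj h
      cases i <;> cases x <;> simp_all [label, lower, raise, e]
    · obtain ⟨u, hu, rfl⟩ := Option.map_eq_some_iff.mp h
      have h1 := f_some hu
      have h2 := ih hu
      -- After `f` has acted inside the tail, a `-` survives there. The letter `x` could cancel it
      -- only if it were the sole one and `x` were labelled `+`; then `x` itself would have carried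
      -- the surviving `+`, which `hc` excludes.
      rw [e, if_neg (by omega), if_neg (by intro h3; exact hc ⟨h3.1, by omega⟩), h2]
      rfl

theorem f_of_e {i : Node} {w w' : List Letter} (h : e i w = some w') : f i w' = some w := by
  induction w generalizing w' with
  | nil => simp [e] at h
  | cons x w ih =>
    rw [e] at h
    split_ifs at h with h1 h2 h3
    · obtain rfl := Option.some.inj h
      cases i <;> cases x <;> simp_all [label, lower, raise, f]
    · obtain ⟨u, hu, rfl⟩ := Option.map_eq_some_iff.mp h
      have h4 := e_some hu
      have h5 := ih hu
      rw [f, if_neg (by rintro ⟨h6, h7⟩; exact h3 ⟨h6, by omega⟩), h5]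
      rfl

theorem iter_add (g : List Letter → Option (List Letter)) (a b : ℕ) (w : List Letter) :
    iter g (a + b) w = (iter g a w).bind (iter g b) := by
  induction a generalizing w with
  | zero => simp [iter]
  | succ a ih =>
    rw [Nat.succ_add]
    simp only [iter, Option.bind_assoc]
    congr 1
    funext u
    exact ih u

theorem iter_inverse {g h : List Letter → Option (List Letter)}
    (hgh : ∀ {w w'}, g w = some w' → h w' = some w) {a : ℕ} {w w' : List Letter}
    (hw : iter g a w = some w') : iter h a w' = some w := by
  induction a generalizing w with
  | zero => simpa [iter, eq_comm] using hw
  | succ a ih =>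
    obtain ⟨u, hu, hu'⟩ := Option.bind_eq_some_iff.mp hw
    rw [iter_add, ih hu']
    simp [iter, hgh hu]

theorem signature_of_iter_f {i : Node} {a : ℕ} {w w' : List Letter}
    (h : iter (f i) a w = some w') :
    (signature i w').1 = (signature i w).1 + a ∧ (signature i w').2 + a = (signature i w).2 := by
  induction a generalizing w with
  | zero =>
    obtain rfl : w = w' := by simpa [iter] using h
    simp
  | succ a ih =>
    obtain ⟨u, hu, hu'⟩ := Option.bind_eq_some_iff.mp h
    have h1 := f_some hu
    have h2 := ih hu'
    omega

/-- The two ends of a symmetric piece of an `i`-string are exchanged by the reflection. -/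
theorem reflect_of_iter_f {i : Node} {k : ℕ} {w w' : List Letter}
    (h : iter (f i) k w = some w') (hk : (signature i w).2 = (signature i w).1 + k) :
    reflect i w = w' ∧ reflect i w' = w := by
  have h1 := signature_of_iter_f h
  constructor
  · unfold reflect
    rw [phi_eq, eps_eq]
    split_ifs with h2
    -- The raising branch of `reflect` applies to the upper word only at the centre of the string.
    · obtain rfl : k = 0 := by omega
      obtain rfl : w = w' := by simpa [iter] using h
      simp [hk, iter]
    · rw [show (signature i w).2 - (signature i w).1 = k by omega, h]
      rfl
  · unfold reflect
    rw [phi_eq, eps_eq, if_pos (by omega),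
      show (signature i w').1 - (signature i w').2 = k by omega, iter_inverse e_of_f h]
    rfl

theorem reflect_reflect (i : Node) (w : List Letter) : reflect i (reflect i w) = w := by
  have h := reflect_some i w
  rw [phi_eq, eps_eq] at h
  split_ifs at h with h1
  · have h2 := iter_inverse f_of_e h.symm
    have h3 := signature_of_iter_f h2
    exact (reflect_of_iter_f h2 (by omega)).1
  · exact (reflect_of_iter_f h.symm (by omega)).2

/-- The inner reflections cancel in pairs because `s₁` is an involution. -/
theorem iter_f12 (a : ℕ) (w : List Letter) :
    iter f12 a w = (iter (f node2) a (reflect node1 w)).map (reflect node1) := by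
  induction a generalizing w with
  | zero => simp [iter, reflect_reflect]
  | succ a ih =>
    rcases h : f node2 (reflect node1 w) with _ | u
    · simp [iter, f12, h]
    · simp [iter, f12, h, ih, reflect_reflect]

theorem phi12_eq (w : List Letter) : phi12 w = (signature node2 (reflect node1 w)).2 := by
  rw [← phi_eq]
  unfold phi12 phi stringLength
  congr 1
  ext a
  simp [iter_f12]

/-! ### Concatenation of words -/

theorem signature_append (i : Node) (u v : List Letter) :
    signature i (u ++ v) =
      ((signature i u).1 + ((signature i v).1 - (signature i u).2),
        (signature i v).2 + ((signature i u).2 - (signature i v).1)) := by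
  induction u with
  | nil => simp [signature]
  | cons x u ih =>
    rw [List.cons_append, signature, signature, ih]
    rcases hu : signature i u with ⟨r1, s1⟩
    rcases hv : signature i v with ⟨r2, s2⟩
    rcases hl : label i x with _ | _ | _
    · rfl
    · rcases r1 with _ | r1
      · simp only [Nat.zero_add]
        rcases hd : r2 - s1 with _ | t <;> simp only [Prod.mk.injEq] <;> omega
      · dsimp only
        rw [show r1 + 1 + (r2 - s1) = (r1 + (r2 - s1)) + 1 by omega]
    · dsimp only
      rw [Prod.mk.injEq]
      omega

/-- The tensor product rule: a `+` of `u` survives exactly if those of `u` outnumber the `-` of `v`,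
and the left-most survivor then lies in `u`. -/
theorem f_append (i : Node) (u v : List Letter) :
    f i (u ++ v) = if (signature i v).1 < (signature i u).2 then (f i u).map (· ++ v)
      else (f i v).map (u ++ ·) := by
  induction u with
  | nil => simp [signature]
  | cons x u ih =>
    rw [List.cons_append, f, f, ih, signature_append]
    rcases hu : signature i u with ⟨r1, s1⟩
    rcases hv : signature i v with ⟨r2, s2⟩
    simp only [signature, hu]
    rcases hl : label i x with _ | _ | _
    · simp only [reduceCtorEq, false_and, if_false]
      split_ifs <;> simp [Function.comp_def]
    · rcases r1 with _ | r1
      · simp only [true_and, if_true]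
        split_ifs <;> first | omega | contradiction | simp [Function.comp_def]
      · simp only [true_and]
        split_ifs <;> first | omega | contradiction | simp [Function.comp_def]
    · simp only [Option.some.injEq, reduceCtorEq, false_and, if_false]
      split_ifs <;> simp [Function.comp_def]

/-- All steps in the left factor precede those in the right one. `hk` says that at least `k` letters
`+` of `u` survive next to `v`, `hl` that none is left after `k` steps; each is waived when the
corresponding number of steps is zero. -/
theorem iter_f_append {i : Node} {k l : ℕ} {u u' v v' : List Letter}
    (hu : iter (f i) k u = some u') (hv : iter (f i) l v = some v')
    (hk : k = 0 ∨ k + (signature i v).1 ≤ (signature i u).2)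
    (hl : l = 0 ∨ (signature i u).2 ≤ k + (signature i v).1) :
    iter (f i) (k + l) (u ++ v) = some (u' ++ v') := by
  induction k generalizing u with
  | zero =>
    obtain rfl : u = u' := by simpa [iter] using hu
    rw [Nat.zero_add]
    clear hu hk
    induction l generalizing v with
    | zero =>
      obtain rfl : v = v' := by simpa [iter] using hv
      rfl
    | succ l ih =>
      obtain ⟨x, hx, hx'⟩ := Option.bind_eq_some_iff.mp hv
      have := f_some hx
      rw [iter, f_append, if_neg (by omega), hx]
      exact ih hx' (by omega)
  | succ k ih =>
    obtain ⟨x, hx, hx'⟩ := Option.bind_eq_some_iff.mp hu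
    have := f_some hx
    rw [Nat.succ_add, iter, f_append, if_pos (by omega), hx]
    exact ih hx' (by omega) (by omega)

/-! ### Words of tableaux, block by block -/

/-- The word `1̄^p 2̄^q`. -/
def barBlock (p q : ℕ) : List Letter := List.replicate p oneBar ++ List.replicate q twoBar

/-- The word `2^r 1^s`. -/
def plainBlock (r s : ℕ) : List Letter := List.replicate r two ++ List.replicate s one

/-- The word `(xy)^k`. -/
def pairBlock (k : ℕ) (x y : Letter) : List Letter :=
  (List.replicate k (x, y)).flatMap fun c => [c.1, c.2]

/-- The word `(2 1̄)^c (2 2̄)^e (1 2̄)^d`. -/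
def midBlock (c e d : ℕ) : List Letter :=
  pairBlock c two oneBar ++ (pairBlock e two twoBar ++ pairBlock d one twoBar)

/-- The word `1̄^p 2̄^q 2^r 1^s (2̄ 1̄)^a (2 1̄)^c (2 2̄)^e (1 2̄)^d (1 2)^b`, where
`m = 2c + e` and `n = 2d + e` with `e ≤ 1`. -/
def blockWord (p q r s a m n b : ℕ) : List Letter :=
  barBlock p q ++ (plainBlock r s ++ (pairBlock a twoBar oneBar ++
    (midBlock (m / 2) (m % 2) (n / 2) ++ pairBlock b one two)))

theorem pairBlock_zero (x y : Letter) : pairBlock 0 x y = [] := rfl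

theorem pairBlock_succ (k : ℕ) (x y : Letter) :
    pairBlock (k + 1) x y = x :: y :: pairBlock k x y := rfl

theorem pairBlock_succ' (k : ℕ) (x y : Letter) :
    pairBlock (k + 1) x y = pairBlock k x y ++ [x, y] := by
  simp [pairBlock, List.replicate_succ']

theorem signature_replicate_plus {i : Node} {x : Letter} (h : label i x = some .plus) (k : ℕ) :
    signature i (List.replicate k x) = (0, k) := by
  induction k with
  | zero => rfl
  | succ k ih => rw [List.replicate_succ, signature, h, ih]

theorem signature_replicate_minus {i : Node} {x : Letter} (h : label i x = some .minus) (k : ℕ) :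
    signature i (List.replicate k x) = (k, 0) := by
  induction k with
  | zero => rfl
  | succ k ih => rw [List.replicate_succ, signature, h, ih]

theorem signature_replicate_none {i : Node} {x : Letter} (h : label i x = none) (k : ℕ) :
    signature i (List.replicate k x) = (0, 0) := by
  induction k with
  | zero => rfl
  | succ k ih => rw [List.replicate_succ, signature, h, ih]

theorem signature_node1_barBlock (p q : ℕ) : signature node1 (barBlock p q) = (p, q) := by
  rw [barBlock, signature_append, signature_replicate_minus rfl, signature_replicate_plus rfl]
  simp

theorem signature_node1_plainBlock (r s : ℕ) : signature node1 (plainBlock r s) = (r, s) := by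
  rw [plainBlock, signature_append, signature_replicate_minus rfl, signature_replicate_plus rfl]
  simp

theorem signature_node2_barBlock (p q : ℕ) : signature node2 (barBlock p q) = (q, 0) := by
  rw [barBlock, signature_append, signature_replicate_none rfl, signature_replicate_minus rfl]
  simp

theorem signature_node2_plainBlock (r s : ℕ) : signature node2 (plainBlock r s) = (0, r) := by
  rw [plainBlock, signature_append, signature_replicate_plus rfl, signature_replicate_none rfl]
  simp

/-- By `h0` only one kind of label survives in a pair, so consecutive pairs do not cancel each
other. -/
theorem signature_pairBlock {i : Node} {x y : Letter} {r s : ℕ} (h : signature i [x, y] = (r, s))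
    (h0 : r = 0 ∨ s = 0) (k : ℕ) : signature i (pairBlock k x y) = (k * r, k * s) := by
  induction k with
  | zero => simp [pairBlock_zero, signature]
  | succ k ih =>
    rw [pairBlock_succ', signature_append, ih, h]
    rcases h0 with rfl | rfl <;> simp [Nat.succ_mul, Nat.add_comm]

theorem signature_node1_midBlock (c e d : ℕ) (he : e ≤ 1) :
    signature node1 (midBlock c e d) = (2 * c + e, 2 * d + e) := by
  rw [midBlock, signature_append, signature_append,
    signature_pairBlock (r := 2) (s := 0) (by rfl) (by simp),
    signature_pairBlock (x := one) (y := twoBar) (r := 0) (s := 2) (by rfl) (by simp)]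
  obtain rfl | rfl : e = 0 ∨ e = 1 := by omega
  · simp [pairBlock_zero, signature, Nat.mul_comm]
  · simp [pairBlock_succ, pairBlock_zero, signature, label, Nat.mul_comm]

theorem signature_node2_midBlock (c e d : ℕ) :
    signature node2 (midBlock c e d) = (d - c, c - d) := by
  rw [midBlock, signature_append, signature_append,
    signature_pairBlock (r := 0) (s := 1) (by rfl) (by simp),
    signature_pairBlock (x := one) (y := twoBar) (r := 1) (s := 0) (by rfl) (by simp),
    signature_pairBlock (x := two) (y := twoBar) (r := 0) (s := 0) (by rfl) (by simp)]
  simp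

theorem signature_node1_blockWord (p q r s a m n b : ℕ) (h : (m + n) % 2 = 0) :
    signature node1 (blockWord p q r s a m n b) =
      (p + (r + (m - s) - q), n + (s - m) + (q - (r + (m - s)))) := by
  have hM := signature_node1_midBlock (m / 2) (m % 2) (n / 2) (by omega)
  rw [show 2 * (m / 2) + m % 2 = m by omega, show 2 * (n / 2) + m % 2 = n by omega] at hM
  simp [blockWord, signature_append, signature_node1_barBlock, signature_node1_plainBlock, hM,
    signature_pairBlock (i := node1) (x := twoBar) (y := oneBar) (r := 0) (s := 0) (by rfl)
      (by simp),
    signature_pairBlock (i := node1) (x := one) (y := two) (r := 0) (s := 0) (by rfl) (by simp)]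

/-- The `2̄`s of the tail stand to the left of every `2`, so they cancel nothing and `q` does not
enter. The truncated subtractions are the successive cancellations. -/
theorem phi2_blockWord (p q r s a m n b : ℕ) :
    (signature node2 (blockWord p q r s a m n b)).2 = b + (r - a + m / 2 - n / 2) := by
  simp only [blockWord, signature_append, signature_node2_barBlock, signature_node2_plainBlock,
    signature_node2_midBlock,
    signature_pairBlock (i := node2) (x := twoBar) (y := oneBar) (r := 1) (s := 0) (by rfl)
      (by simp),
    signature_pairBlock (i := node2) (x := one) (y := two) (r := 0) (s := 1) (by rfl) (by simp)]
  omega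

/-! ### The `1`-strings of the blocks -/

theorem iter_f_barBlock (k p q : ℕ) :
    iter (f node1) k (barBlock p (q + k)) = some (barBlock (p + k) q) := by
  induction k generalizing p with
  | zero => rfl
  | succ k ih =>
    have : f node1 (barBlock p (q + k + 1)) = some (barBlock (p + 1) (q + k)) := by
      rw [barBlock, f_append, signature_replicate_minus (x := oneBar) rfl, if_neg (by simp),
        List.replicate_succ, f, signature_replicate_plus rfl]
      simp [barBlock, label, lower, List.replicate_succ']
    rw [← Nat.add_assoc, iter, this, Option.bind_some, ih, Nat.add_right_comm, Nat.add_assoc]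

theorem iter_f_plainBlock (k r s : ℕ) :
    iter (f node1) k (plainBlock r (s + k)) = some (plainBlock (r + k) s) := by
  induction k generalizing r with
  | zero => rfl
  | succ k ih =>
    have : f node1 (plainBlock r (s + k + 1)) = some (plainBlock (r + 1) (s + k)) := by
      rw [plainBlock, f_append, signature_replicate_minus (x := two) rfl, if_neg (by simp),
        List.replicate_succ, f, signature_replicate_plus rfl]
      simp [plainBlock, label, lower, List.replicate_succ']
    rw [← Nat.add_assoc, iter, this, Option.bind_some, ih, Nat.add_right_comm, Nat.add_assoc]

theorem f_midBlock_even (c d : ℕ) :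
    f node1 (midBlock c 0 (d + 1)) = some (midBlock c 1 d) := by
  rw [midBlock, f_append, signature_pairBlock (r := 2) (s := 0) (by rfl) (by simp),
    if_neg (by simp), pairBlock_zero, List.nil_append, pairBlock_succ, f, signature,
    signature_pairBlock (r := 0) (s := 2) (by rfl) (by simp)]
  simp [midBlock, label, lower, pairBlock_succ, pairBlock_zero]

theorem f_midBlock_odd (c d : ℕ) :
    f node1 (midBlock c 1 d) = some (midBlock (c + 1) 0 d) := by
  rw [midBlock, f_append, signature_pairBlock (r := 2) (s := 0) (by rfl) (by simp),
    if_neg (by simp), pairBlock_succ, pairBlock_zero]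
  simp only [List.cons_append, List.nil_append, f, signature,
    signature_pairBlock (i := node1) (x := one) (y := twoBar) (r := 0) (s := 2) (by rfl) (by simp)]
  simp [midBlock, label, lower, pairBlock_succ', pairBlock_zero]

/-- Each step follows `12̄ → 22̄ → 21̄`, creating or removing the single pair `22̄`; so `m` rises
and `n` falls by one, with their common parity recording that pair. -/
theorem iter_f_midBlock (k m n : ℕ) (h : (m + n + k) % 2 = 0) :
    iter (f node1) k (midBlock (m / 2) (m % 2) ((n + k) / 2)) =
      some (midBlock ((m + k) / 2) ((m + k) % 2) (n / 2)) := by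
  induction k generalizing m with
  | zero => rfl
  | succ k ih =>
    have : f node1 (midBlock (m / 2) (m % 2) ((n + k + 1) / 2)) =
        some (midBlock ((m + 1) / 2) ((m + 1) % 2) ((n + k) / 2)) := by
      obtain h0 | h0 : m % 2 = 0 ∨ m % 2 = 1 := by omega
      · rw [h0, show (n + k + 1) / 2 = (n + k) / 2 + 1 by omega, f_midBlock_even,
          show (m + 1) / 2 = m / 2 by omega, show (m + 1) % 2 = 1 by omega]
      · rw [h0, show (n + k + 1) / 2 = (n + k) / 2 by omega, f_midBlock_odd,
          show (m + 1) / 2 = m / 2 + 1 by omega, show (m + 1) % 2 = 0 by omega]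
    rw [← Nat.add_assoc, iter, this, Option.bind_some, ih _ (by omega),
      show m + 1 + k = m + (k + 1) by omega]

/-- The tensor product rule for the three non-trivial blocks of a word. -/
theorem iter_f_blockWord {x y z p q r s a m n b : ℕ} (h : (m + n + z) % 2 = 0)
    (hx : x = 0 ∨ r + (m - (s + y)) ≤ q)
    (hy : y = 0 ∨ q + x ≤ x + (r + (m - (s + y))) ∧ m ≤ s)
    (hz : z = 0 ∨ q + x ≤ x + (r + (m - (s + y))) ∧ s + y ≤ y + m) :
    iter (f node1) (x + (y + z)) (blockWord p (q + x) r (s + y) a m (n + z) b) =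
      some (blockWord (p + x) q (r + y) s a (m + z) n b) := by
  have hM := signature_node1_midBlock (m / 2) (m % 2) ((n + z) / 2) (by omega)
  have hA : signature node1 (pairBlock a twoBar oneBar) = (0, 0) :=
    signature_pairBlock (r := 0) (s := 0) (by rfl) (by simp) a
  have hB : signature node1 (pairBlock b one two) = (0, 0) :=
    signature_pairBlock (r := 0) (s := 0) (by rfl) (by simp) b
  have h1 := iter_f_append (iter_f_midBlock z m n h)
    (show iter (f node1) 0 (pairBlock b one two) = some _ from rfl)
    (by rw [hM, hB]; simp only; omega) (by simp)
  have h2 := iter_f_append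
    (show iter (f node1) 0 (pairBlock a twoBar oneBar) = some _ from rfl) h1 (by simp)
    (by rw [hA]; simp)
  have h3 := iter_f_append (iter_f_plainBlock y r s) h2
    (by simp only [signature_append, hM, hA, hB, signature_node1_plainBlock]; omega)
    (by simp only [signature_append, hM, hA, hB, signature_node1_plainBlock]; omega)
  have h4 := iter_f_append (iter_f_barBlock x p q) h3
    (by simp only [signature_append, hM, hA, hB, signature_node1_plainBlock,
          signature_node1_barBlock]; omega)
    (by simp only [signature_append, hM, hA, hB, signature_node1_plainBlock,
          signature_node1_barBlock]; omega)
  simpa [blockWord] using h4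

/-- `φ₁₂` of a word, when its `1`-string has to be followed downwards to the reflected word. -/
theorem phi12_blockWord {x y z p q r s a m n b : ℕ} (h : (m + n + z) % 2 = 0)
    (hx : x = 0 ∨ r + (m - (s + y)) ≤ q)
    (hy : y = 0 ∨ q + x ≤ x + (r + (m - (s + y))) ∧ m ≤ s)
    (hz : z = 0 ∨ q + x ≤ x + (r + (m - (s + y))) ∧ s + y ≤ y + m)
    (hk : q + s + n = p + r + m) :
    phi12 (blockWord p (q + x) r (s + y) a m (n + z) b) =
        b + (r + y - a + (m + z) / 2 - n / 2) ∧
      phi12 (blockWord (p + x) q (r + y) s a (m + z) n b) =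
        b + (r - a + m / 2 - (n + z) / 2) := by
  -- By `hk`, `x + y + z` is the excess `φ₁ - ε₁` of the upper word, so the two words are mirror
  -- images in their `1`-string.
  have h1 := reflect_of_iter_f (iter_f_blockWord (p := p) (a := a) (b := b) h hx hy hz) (by
    rw [signature_node1_blockWord _ _ _ _ _ _ _ _ (by omega)]
    simp only
    omega)
  rw [phi12_eq, phi12_eq, h1.1, h1.2, phi2_blockWord, phi2_blockWord]
  exact ⟨rfl, rfl⟩

/-! ### The value of `Z` on words -/

/-- The reflection goes down `k = φ₁ - ε₁` steps. It uses the surviving `+` greedily from the left: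
`x` in the bar block, `y` in the plain block, `z` in the middle block. The listed constraints encode
this greedy choice. -/
theorem exists_phi12_of_le (p q r s a m n b : ℕ) (h : (m + n) % 2 = 0)
    (hw : p + r + m ≤ q + s + n) :
    ∃ x y z : ℕ, x + y + z + (p + r + m) = q + s + n ∧ x ≤ q ∧ y ≤ s ∧ z ≤ n ∧
      (x = 0 ∨ r + (m - s) + x ≤ q) ∧ (y = 0 ∨ q ≤ x + (r + (m - s)) ∧ m + y ≤ s) ∧
      (z = 0 ∨ q ≤ x + (r + (m - s)) ∧ s ≤ y + m) ∧
      phi12 (blockWord p q r s a m n b) = b + (r + y - a + (m + z) / 2 - (n - z) / 2) := by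
  obtain ⟨k, hk⟩ := Nat.exists_eq_add_of_le hw
  obtain ⟨x, hx⟩ : ∃ x, x = min k (q - (r + (m - s))) := ⟨_, rfl⟩
  obtain ⟨y, hy⟩ : ∃ y, y = min (k - x) (s - m) := ⟨_, rfl⟩
  obtain ⟨z, hz⟩ : ∃ z, z = k - x - y := ⟨_, rfl⟩
  obtain ⟨q, rfl⟩ := Nat.exists_eq_add_of_le' (show x ≤ q by omega)
  obtain ⟨s, rfl⟩ := Nat.exists_eq_add_of_le' (show y ≤ s by omega)
  obtain ⟨n, rfl⟩ := Nat.exists_eq_add_of_le' (show z ≤ n by omega)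
  refine ⟨x, y, z, by omega, by omega, by omega, by omega, by omega, by omega, by omega, ?_⟩
  rw [(phi12_blockWord (by omega) (by omega) (by omega) (by omega) (by omega)).1,
    Nat.add_sub_cancel]

/-- Here the given word is the lower one, and `e₁` uses the surviving `-` greedily from the right:
first `z`, then `y`, then `x`. -/
theorem exists_phi12_of_ge (p q r s a m n b : ℕ) (h : (m + n) % 2 = 0)
    (hw : q + s + n ≤ p + r + m) :
    ∃ x y z : ℕ, x + y + z + (q + s + n) = p + r + m ∧ x ≤ p ∧ y ≤ r ∧ z ≤ m ∧
      (z = 0 ∨ s + (q - r) + z ≤ m) ∧ (y = 0 ∨ m ≤ z + (s + (q - r)) ∧ q + y ≤ r) ∧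
      (x = 0 ∨ m ≤ z + (s + (q - r)) ∧ r ≤ y + q) ∧
      phi12 (blockWord p q r s a m n b) = b + (r - y - a + (m - z) / 2 - (n + z) / 2) := by
  obtain ⟨k, hk⟩ := Nat.exists_eq_add_of_le hw
  obtain ⟨z, hz⟩ : ∃ z, z = min k (m - (s + (q - r))) := ⟨_, rfl⟩
  obtain ⟨y, hy⟩ : ∃ y, y = min (k - z) (r - q) := ⟨_, rfl⟩
  obtain ⟨x, hx⟩ : ∃ x, x = k - z - y := ⟨_, rfl⟩
  obtain ⟨p, rfl⟩ := Nat.exists_eq_add_of_le' (show x ≤ p by omega)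
  obtain ⟨r, rfl⟩ := Nat.exists_eq_add_of_le' (show y ≤ r by omega)
  obtain ⟨m, rfl⟩ := Nat.exists_eq_add_of_le' (show z ≤ m by omega)
  refine ⟨x, y, z, by omega, by omega, by omega, by omega, by omega, by omega, by omega, ?_⟩
  rw [(phi12_blockWord (by omega) (by omega) (by omega) (by omega) (by omega)).2]
  simp only [Nat.add_sub_cancel]

/-- `φ₁ + φ₂ + φ₁₂` of a word. -/
noncomputable def wordZ (w : List Letter) : ℕ := phi node1 w + phi node2 w + phi12 w

theorem wordZ_blockWord (p q r s a m n b : ℕ) (h : (m + n) % 2 = 0) :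
    wordZ (blockWord p q r s a m n b) = n + (s - m) + (q - (r + (m - s))) +
      (b + (r - a + m / 2 - n / 2)) + phi12 (blockWord p q r s a m n b) := by
  rw [wordZ, phi_eq, phi_eq, signature_node1_blockWord _ _ _ _ _ _ _ _ h, phi2_blockWord]

/-! ### Change of `Z` under the embedding -/

/-- In the downward reflection the new `1` either is not needed or takes over one step from the
middle block. Since `n` is even, that exchange alters `z / 2 - (n - z) / 2` by exactly one, so `φ₁₂`
is unchanged; only `φ₁` grows. -/
theorem wordZ_embed_one (p q r s n b : ℕ) (h : n % 2 = 0) :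
    wordZ (blockWord (p + 1) q r (s + 1) 0 0 n b) = wordZ (blockWord p q r s 0 0 n b) + 1 := by
  rw [wordZ_blockWord _ _ _ _ _ _ _ _ (by omega), wordZ_blockWord _ _ _ _ _ _ _ _ (by omega)]
  rcases Nat.le_total (p + r + 0) (q + s + n) with hw | hw
  · obtain ⟨x, y, z, h1, h2, h3, h4, h5, h6, h7, h8⟩ :=
      exists_phi12_of_le p q r s 0 0 n b (by omega) hw
    obtain ⟨x', y', z', i1, i2, i3, i4, i5, i6, i7, i8⟩ :=
      exists_phi12_of_le (p + 1) q r (s + 1) 0 0 n b (by omega) (by omega)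
    have hx : x' = x := by clear h8 i8; omega
    subst hx
    have hy : y' = y ∧ z = 0 ∧ z' = 0 ∨ y' = y + 1 ∧ z = z' + 1 ∧ y = s ∧ q ≤ x' + r := by
      clear h8 i8; omega
    rw [h8, i8]
    clear h8 i8
    rcases hy with ⟨rfl, rfl, rfl⟩ | ⟨rfl, rfl, rfl, h9⟩ <;> clear h5 h6 h7 i5 i6 i7 <;>
      omega
  · obtain ⟨x, y, z, h1, h2, h3, h4, h5, h6, h7, h8⟩ :=
      exists_phi12_of_ge p q r s 0 0 n b (by omega) hw
    obtain ⟨x', y', z', i1, i2, i3, i4, i5, i6, i7, i8⟩ :=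
      exists_phi12_of_ge (p + 1) q r (s + 1) 0 0 n b (by omega) (by omega)
    have hx : z' = z := by clear h8 i8; omega
    have hy : y' = y := by clear h8 i8; omega
    subst hx hy
    rw [h8, i8]
    clear h8 i8
    omega

/-- As `m + 1` and `n` have equal parity, the new `2` compensates the change of `m / 2 - n / 2`. The
same parity argument applies to the reflected word. -/
theorem wordZ_embed_two (p q r m n b : ℕ) (h : (m + n) % 2 = 1) :
    wordZ (blockWord (p + 1) q (r + 1) 0 0 m (n + 1) b) =
      wordZ (blockWord p q r 0 0 (m + 1) n b) + 1 := by
  rw [wordZ_blockWord _ _ _ _ _ _ _ _ (by omega), wordZ_blockWord _ _ _ _ _ _ _ _ (by omega)]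
  rcases Nat.le_total (p + r + (m + 1)) (q + 0 + n) with hw | hw
  · obtain ⟨x, y, z, h1, h2, h3, h4, h5, h6, h7, h8⟩ :=
      exists_phi12_of_le p q r 0 0 (m + 1) n b (by omega) hw
    obtain ⟨x', y', z', i1, i2, i3, i4, i5, i6, i7, i8⟩ :=
      exists_phi12_of_le (p + 1) q (r + 1) 0 0 m (n + 1) b (by omega) (by omega)
    obtain rfl : y = 0 := by omega
    obtain rfl : y' = 0 := by omega
    have hx : x' = x := by clear h8 i8; omega
    have hz : z' = z := by clear h8 i8; omega
    subst hx hz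
    rw [h8, i8]
    clear h8 i8
    simp only [Nat.zero_sub, Nat.sub_zero, Nat.add_zero]
    omega
  · obtain ⟨x, y, z, h1, h2, h3, h4, h5, h6, h7, h8⟩ :=
      exists_phi12_of_ge p q r 0 0 (m + 1) n b (by omega) hw
    obtain ⟨x', y', z', i1, i2, i3, i4, i5, i6, i7, i8⟩ :=
      exists_phi12_of_ge (p + 1) q (r + 1) 0 0 m (n + 1) b (by omega) (by omega)
    have hx : x' = x := by clear h8 i8; omega
    subst hx
    have hy : z' = z ∧ y' = 0 ∧ y = 0 ∨ z = m + 1 ∧ z' = m ∧ y' = y + 1 ∧ q ≤ r := by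
      clear h8 i8; omega
    rw [h8, i8]
    clear h8 i8
    rcases hy with ⟨rfl, rfl, rfl⟩ | ⟨rfl, rfl, rfl, h9⟩ <;> clear h5 h6 h7 i5 i6 i7 <;>
      simp only [Nat.zero_sub, Nat.sub_zero, Nat.add_zero, Nat.sub_self] <;> omega

/-- With `r = s = 0` the term `r - a` vanishes by truncation, so losing a pair `2̄1̄` does not
affect `φ₂`; equal parity of `m` and `n` keeps `m / 2 - n / 2` when both grow by one. -/
theorem wordZ_embed_twoBar (p q a m n b : ℕ) (h : (m + n) % 2 = 0) :
    wordZ (blockWord (p + 1) (q + 1) 0 0 a (m + 1) (n + 1) b) =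
      wordZ (blockWord p q 0 0 (a + 1) m n b) + 1 := by
  rw [wordZ_blockWord _ _ _ _ _ _ _ _ (by omega), wordZ_blockWord _ _ _ _ _ _ _ _ (by omega)]
  rcases Nat.le_total (p + 0 + m) (q + 0 + n) with hw | hw
  · obtain ⟨x, y, z, h1, h2, h3, h4, h5, h6, h7, h8⟩ :=
      exists_phi12_of_le p q 0 0 (a + 1) m n b (by omega) hw
    obtain ⟨x', y', z', i1, i2, i3, i4, i5, i6, i7, i8⟩ :=
      exists_phi12_of_le (p + 1) (q + 1) 0 0 a (m + 1) (n + 1) b (by omega) (by omega)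
    obtain rfl : y = 0 := by omega
    obtain rfl : y' = 0 := by omega
    have hx : x' = x := by clear h8 i8; omega
    have hz : z' = z := by clear h8 i8; omega
    subst hx hz
    rw [h8, i8]
    clear h8 i8
    simp only [Nat.zero_sub, Nat.sub_zero, Nat.add_zero]
    omega
  · obtain ⟨x, y, z, h1, h2, h3, h4, h5, h6, h7, h8⟩ :=
      exists_phi12_of_ge p q 0 0 (a + 1) m n b (by omega) hw
    obtain ⟨x', y', z', i1, i2, i3, i4, i5, i6, i7, i8⟩ :=
      exists_phi12_of_ge (p + 1) (q + 1) 0 0 a (m + 1) (n + 1) b (by omega) (by omega)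
    obtain rfl : y = 0 := by omega
    obtain rfl : y' = 0 := by omega
    have hx : x' = x := by clear h8 i8; omega
    have hz : z' = z := by clear h8 i8; omega
    subst hx hz
    rw [h8, i8]
    clear h8 i8
    simp only [Nat.zero_sub, Nat.sub_zero, Nat.add_zero]
    omega

/-! ### Words outside the image of the embedding -/

/-- The cases in which a valid tableau lies outside the image of the embedding. -/
theorem cases_of_not_embed {p q r s a m n : ℕ} (hs : m = 0 ∨ s = 0)
    (ha : a = 0 ∨ r = 0 ∧ s = 0) (h1 : ¬(0 < p ∧ 0 < s ∧ a = 0 ∧ m = 0))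
    (h2 : ¬(0 < p ∧ 0 < r ∧ 0 < n ∧ s = 0 ∧ a = 0))
    (h3 : ¬(0 < p ∧ 0 < q ∧ 0 < m ∧ 0 < n ∧ r = 0 ∧ s = 0)) :
    (p = 0 ∧ m = 0 ∧ a = 0) ∨ (p = 0 ∧ s = 0 ∧ a = 0) ∨ (p = 0 ∧ s = 0 ∧ r = 0) ∨
      (s = 0 ∧ n = 0 ∧ a = 0) ∨ (s = 0 ∧ n = 0 ∧ r = 0) ∨ (s = 0 ∧ r = 0 ∧ q = 0) ∨
      (s = 0 ∧ r = 0 ∧ m = 0) := by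
  rcases Nat.eq_zero_or_pos p with hp | hp
  · rcases hs with hs | hs <;> rcases ha with ha | ha <;> simp [hp, hs, ha]
  · rcases Nat.eq_zero_or_pos s with hs' | hs'
    · rcases Nat.eq_zero_or_pos r with hr | hr
      · grind
      · grind
    · grind

set_option maxHeartbeats 1000000 in
theorem wordZ_of_not_embed_of_le (p q r s a m n b M : ℕ) (h : (m + n) % 2 = 0)
    (hc : (p = 0 ∧ m = 0 ∧ a = 0) ∨ (p = 0 ∧ s = 0 ∧ a = 0) ∨ (p = 0 ∧ s = 0 ∧ r = 0) ∨
      (s = 0 ∧ n = 0 ∧ a = 0) ∨ (s = 0 ∧ n = 0 ∧ r = 0) ∨ (s = 0 ∧ r = 0 ∧ q = 0) ∨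
      (s = 0 ∧ r = 0 ∧ m = 0))
    (hw : p + r + m ≤ q + s + n)
    (hM : (M : ℤ) = max 0 (|(s + q + n : ℤ) - (p + r + m)| - (p + q + r + s))) :
    (2 * wordZ (blockWord p q r s a m n b) : ℤ) =
      2 * (p + q + r + s) + 2 * (a + b) + (m + n) + 2 * ((s + q + n : ℤ) - (p + r + m)) +
        2 * (r - q + b - a : ℤ) + (m - n) + M := by
  rw [wordZ_blockWord _ _ _ _ _ _ _ _ h]
  rw [abs_of_nonneg (by omega)] at hM
  obtain ⟨x, y, z, h1, h2, h3, h4, h5, h6, h7, h8⟩ :=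
    exists_phi12_of_le p q r s a m n b h hw
  rw [h8]
  clear h8
  rcases hc with ⟨rfl, rfl, rfl⟩ | ⟨rfl, rfl, rfl⟩ | ⟨rfl, rfl, rfl⟩ | ⟨rfl, rfl, rfl⟩ |
    ⟨rfl, rfl, rfl⟩ | ⟨rfl, rfl, rfl⟩ | ⟨rfl, rfl, rfl⟩
  -- In these two families `n = 0`, so `m` is even.
  case inr.inr.inr.inl | inr.inr.inr.inr.inl =>
    obtain ⟨j, rfl⟩ : ∃ j, m = 2 * j := ⟨m / 2, by omega⟩
    simp only [Nat.zero_sub, Nat.sub_zero, Nat.add_zero, Nat.zero_add, Nat.zero_div,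
      Nat.mul_div_cancel_left j Nat.two_pos] at *
    rcases max_cases (0 : ℤ) _ with hm | hm <;> rw [hm.1] at hM <;> omega
  all_goals
    simp only [Nat.zero_sub, Nat.sub_zero, Nat.add_zero, Nat.zero_add, Nat.zero_div] at *
    rcases max_cases (0 : ℤ) _ with hm | hm <;> rw [hm.1] at hM <;> omega

set_option maxHeartbeats 1000000 in
theorem wordZ_of_not_embed_of_ge (p q r s a m n b M : ℕ) (h : (m + n) % 2 = 0)
    (hc : (p = 0 ∧ m = 0 ∧ a = 0) ∨ (p = 0 ∧ s = 0 ∧ a = 0) ∨ (p = 0 ∧ s = 0 ∧ r = 0) ∨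
      (s = 0 ∧ n = 0 ∧ a = 0) ∨ (s = 0 ∧ n = 0 ∧ r = 0) ∨ (s = 0 ∧ r = 0 ∧ q = 0) ∨
      (s = 0 ∧ r = 0 ∧ m = 0))
    (hw : q + s + n ≤ p + r + m)
    (hM : (M : ℤ) = max 0 (|(s + q + n : ℤ) - (p + r + m)| - (p + q + r + s))) :
    (2 * wordZ (blockWord p q r s a m n b) : ℤ) =
      2 * (p + q + r + s) + 2 * (a + b) + (m + n) + 2 * ((s + q + n : ℤ) - (p + r + m)) +
        2 * (r - q + b - a : ℤ) + (m - n) + M := by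
  rw [wordZ_blockWord _ _ _ _ _ _ _ _ h]
  rw [abs_of_nonpos (by omega)] at hM
  obtain ⟨x, y, z, h1, h2, h3, h4, h5, h6, h7, h8⟩ :=
    exists_phi12_of_ge p q r s a m n b h hw
  rw [h8]
  clear h8
  rcases hc with ⟨rfl, rfl, rfl⟩ | ⟨rfl, rfl, rfl⟩ | ⟨rfl, rfl, rfl⟩ | ⟨rfl, rfl, rfl⟩ |
    ⟨rfl, rfl, rfl⟩ | ⟨rfl, rfl, rfl⟩ | ⟨rfl, rfl, rfl⟩
  case inr.inr.inr.inl | inr.inr.inr.inr.inl =>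
    obtain ⟨j, rfl⟩ : ∃ j, m = 2 * j := ⟨m / 2, by omega⟩
    simp only [Nat.zero_sub, Nat.sub_zero, Nat.add_zero, Nat.zero_add, Nat.zero_div,
      Nat.mul_div_cancel_left j Nat.two_pos] at *
    rcases max_cases (0 : ℤ) _ with hm | hm <;> rw [hm.1] at hM <;> omega
  all_goals
    simp only [Nat.zero_sub, Nat.sub_zero, Nat.add_zero, Nat.zero_add, Nat.zero_div] at *
    rcases max_cases (0 : ℤ) _ with hm | hm <;> rw [hm.1] at hM <;> omega

/-- The value of `Z` on words of tableaux outside the image of the embedding; `M` is twice the term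
`max (0, (|μ₁| - λ₁) / 2)`. -/
theorem wordZ_of_not_embed (p q r s a m n b M : ℕ) (h : (m + n) % 2 = 0)
    (hc : (p = 0 ∧ m = 0 ∧ a = 0) ∨ (p = 0 ∧ s = 0 ∧ a = 0) ∨ (p = 0 ∧ s = 0 ∧ r = 0) ∨
      (s = 0 ∧ n = 0 ∧ a = 0) ∨ (s = 0 ∧ n = 0 ∧ r = 0) ∨ (s = 0 ∧ r = 0 ∧ q = 0) ∨
      (s = 0 ∧ r = 0 ∧ m = 0))
    (hM : (M : ℤ) = max 0 (|(s + q + n : ℤ) - (p + r + m)| - (p + q + r + s))) :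
    (2 * wordZ (blockWord p q r s a m n b) : ℤ) =
      2 * (p + q + r + s) + 2 * (a + b) + (m + n) + 2 * ((s + q + n : ℤ) - (p + r + m)) +
        2 * (r - q + b - a : ℤ) + (m - n) + M := by
  rcases Nat.le_total (p + r + m) (q + s + n) with hw | hw
  · exact wordZ_of_not_embed_of_le p q r s a m n b M h hc hw hM
  · exact wordZ_of_not_embed_of_ge p q r s a m n b M h hc hw hM

/-! ### Tableaux, block by block -/

/-- The columns `(12)^b (12̄)^d (22̄)^e (21̄)^c (2̄1̄)^a`. -/
def blockCols (a c e d b : ℕ) : List (Letter × Letter) :=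
  List.replicate b (one, two) ++ (List.replicate d (one, twoBar) ++
    (List.replicate e (two, twoBar) ++ (List.replicate c (two, oneBar) ++
      List.replicate a (twoBar, oneBar))))

/-- The row `1^s 2^r 2̄^q 1̄^p`. -/
def blockTail (p q r s : ℕ) : List Letter :=
  List.replicate s one ++ (List.replicate r two ++
    (List.replicate q twoBar ++ List.replicate p oneBar))

/-- The tableau with columns `blockCols` followed by `blockTail`. -/
def blockTableau (p q r s a c e d b : ℕ) : Tableau := ⟨blockCols a c e d b, blockTail p q r s⟩

theorem word_blockTableau (p q r s a c e d b : ℕ) (he : e ≤ 1) :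
    (blockTableau p q r s a c e d b).word =
      blockWord p q r s a (2 * c + e) (2 * d + e) b := by
  rw [blockWord, show (2 * c + e) / 2 = c by omega, show (2 * c + e) % 2 = e by omega,
    show (2 * d + e) / 2 = d by omega]
  simp [blockTableau, blockCols, blockTail, word, barBlock, plainBlock, midBlock, pairBlock]

theorem wt1_blockTableau (p q r s a c e d b : ℕ) :
    (blockTableau p q r s a c e d b).wt1 =
      (s + q + (2 * d + e) : ℤ) - (p + r + (2 * c + e)) := by
  simp [blockTableau, blockCols, blockTail, wt1, num, topRow, bottomRow, List.count_replicate]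
  ring

theorem wt2_blockTableau (p q r s a c e d b : ℕ) :
    (blockTableau p q r s a c e d b).wt2 = (r - q + b - a + c - d : ℤ) := by
  simp [blockTableau, blockCols, blockTail, wt2, num, topRow, bottomRow, List.count_replicate]
  ring

theorem Letter.eq_blockTail {l : List Letter} (h : l.Pairwise (· ≤ ·)) :
    l = blockTail (l.count oneBar) (l.count twoBar) (l.count two) (l.count one) := by
  refine List.Perm.eq_of_pairwise (le := (· ≤ ·)) (fun _ _ _ _ => le_antisymm) h ?_ ?_
  · simp only [blockTail, List.pairwise_append, List.pairwise_replicate, List.mem_append,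
      List.mem_replicate]
    refine ⟨by simp, ⟨by simp, ⟨by simp, by simp, ?_⟩, ?_⟩, ?_⟩ <;>
      rintro x ⟨-, rfl⟩ y hy <;>
      rcases y <;> first | decide | simp at hy
  · rw [List.perm_iff_count]
    intro x
    cases x <;> simp [blockTail, List.count_replicate]

theorem pairwise_blockCols (a c e d b : ℕ) :
    (blockCols a c e d b).Pairwise fun x y => x.1 ≤ y.1 ∧ x.2 ≤ y.2 := by
  simp only [blockCols, List.pairwise_append, List.pairwise_replicate, List.mem_append,
    List.mem_replicate]
  refine ⟨by simp, ⟨by simp, ⟨by simp, ⟨by simp, by simp, ?_⟩, ?_⟩, ?_⟩, ?_⟩ <;>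
    rintro x ⟨-, rfl⟩ ⟨y, z⟩ hy <;>
    rcases y <;> rcases z <;> first | decide | simp at hy

/-- The five admissible columns form a chain in the product order, so a sorted list of them is
determined by its multiplicities. The excluded column `1, 1̄` would be incomparable to `2, 2̄`. -/
theorem eq_blockCols {l : List (Letter × Letter)}
    (h : l.Pairwise fun x y => x.1 ≤ y.1 ∧ x.2 ≤ y.2) (hl : ∀ x ∈ l, x.1 < x.2)
    (hl' : ∀ x ∈ l, x ≠ (one, oneBar)) :
    l = blockCols (l.count (twoBar, oneBar)) (l.count (two, oneBar)) (l.count (two, twoBar))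
      (l.count (one, twoBar)) (l.count (one, two)) := by
  refine List.Perm.eq_of_pairwise (le := fun x y => x.1 ≤ y.1 ∧ x.2 ≤ y.2)
    (fun x y _ _ h1 h2 => Prod.ext (le_antisymm h1.1 h2.1) (le_antisymm h1.2 h2.2)) h
    (pairwise_blockCols _ _ _ _ _) ?_
  rw [List.perm_iff_count]
  rintro ⟨x, y⟩
  by_cases hxy : x < y ∧ (x, y) ≠ (one, oneBar)
  · obtain ⟨h1, h2⟩ := hxy
    cases x <;> cases y <;>
      first
        | exact absurd h1 (by decide)
        | exact absurd rfl h2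
        | simp [blockCols, List.count_replicate]
  · rw [List.count_eq_zero_of_not_mem (fun hm => hxy ⟨hl _ hm, hl' _ hm⟩)]
    cases x <;> cases y <;>
      first
        | exact absurd (by decide) hxy
        | simp [blockCols, List.count_replicate]

theorem flatMap_replicate_pair {α : Type*} (k : ℕ) (x : α) :
    (List.replicate k x).flatMap (fun x => [x, x]) = List.replicate (2 * k) x := by
  induction k with
  | zero => rfl
  | succ k ih => rw [List.replicate_succ, List.flatMap_cons, ih]; rfl

theorem flatMap_replicate_splitCol (k : ℕ) {c : Letter × Letter} (hc : c ≠ (two, twoBar)) :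
    (List.replicate k c).flatMap splitCol = List.replicate (2 * k) c := by
  rw [← flatMap_replicate_pair]
  simp [List.flatMap_replicate, splitCol, hc]

theorem split_blockTableau (p q r s a c e d b : ℕ) (he : e ≤ 1) :
    (blockTableau p q r s a c e d b).split =
      blockTableau (2 * p) (2 * q) (2 * r) (2 * s) (2 * a) (2 * c + e) 0 (2 * d + e) (2 * b) := by
  simp only [blockTableau, split, blockCols, blockTail, List.flatMap_append,
    flatMap_replicate_pair, Tableau.mk.injEq, and_true]
  rw [flatMap_replicate_splitCol b (by decide), flatMap_replicate_splitCol d (by decide),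
    flatMap_replicate_splitCol c (by decide), flatMap_replicate_splitCol a (by decide)]
  obtain rfl | rfl : e = 0 ∨ e = 1 := by omega
  · simp
  · rw [List.replicate_succ' (n := 2 * d), List.replicate_succ (n := 2 * c)]
    simp [splitCol]

theorem isSemistandard_blockTableau {p q r s a c e d b : ℕ} (hs : c + e = 0 ∨ s = 0)
    (ha : a = 0 ∨ r = 0 ∧ s = 0) : (blockTableau p q r s a c e d b).IsSemistandard := by
  have hc := pairwise_blockCols a c e d b
  refine ⟨?_, ?_, ?_⟩
  · rw [topRow, List.pairwise_append]
    refine ⟨(hc.imp fun h => h.1).map _ fun _ _ h => h, ?_, ?_⟩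
    · simp only [blockTableau, blockTail, List.pairwise_append, List.pairwise_replicate,
        List.mem_append, List.mem_replicate]
      refine ⟨by simp, ⟨by simp, ⟨by simp, by simp, ?_⟩, ?_⟩, ?_⟩ <;>
        rintro x ⟨-, rfl⟩ y hy <;>
        rcases y <;> first | decide | simp at hy
    · simp only [blockTableau, blockCols, blockTail, List.map_append, List.map_replicate,
        List.mem_append, List.mem_replicate]
      intro x hx y hy
      cases x <;> cases y <;> first | decide | (simp at hx hy <;> omega)
  · exact (hc.imp fun h => h.2).map _ fun _ _ h => h
  · simp only [blockTableau, blockCols, List.mem_append, List.mem_replicate]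
    rintro x (⟨-, rfl⟩ | ⟨-, rfl⟩ | ⟨-, rfl⟩ | ⟨-, rfl⟩ | ⟨-, rfl⟩) <;> decide

theorem blockTableau_mem_crystal {p q r s a c e d b : ℕ} (he : e ≤ 1)
    (hs : c + e = 0 ∨ s = 0) (ha : a = 0 ∨ r = 0 ∧ s = 0) :
    blockTableau p q r s a c e d b ∈ crystal (p + q + r + s) (a + c + e + d + b) := by
  refine ⟨⟨isSemistandard_blockTableau hs ha, ?_, ?_⟩, ?_, ?_⟩
  · simp only [blockTableau, blockCols, List.mem_append, List.mem_replicate]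
    rintro x (⟨-, rfl⟩ | ⟨-, rfl⟩ | ⟨-, rfl⟩ | ⟨-, rfl⟩ | ⟨-, rfl⟩) <;> decide
  · rw [split_blockTableau _ _ _ _ _ _ _ _ _ he]
    exact isSemistandard_blockTableau (by omega) (by omega)
  · simp [blockTableau, blockCols]
    omega
  · simp [blockTableau, blockTail]
    omega

theorem exists_eq_blockTableau {l1 l2 : ℕ} {T : Tableau} (hT : T ∈ crystal l1 l2) :
    ∃ p q r s a c e d b : ℕ, T = blockTableau p q r s a c e d b ∧ e ≤ 1 ∧
      (c + e = 0 ∨ s = 0) ∧ (a = 0 ∨ r = 0 ∧ s = 0) ∧ l1 = p + q + r + s ∧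
      l2 = a + c + e + d + b := by
  obtain ⟨⟨⟨h1, h2, h3⟩, h4, h5⟩, hl2, hl1⟩ := hT
  rw [topRow, List.pairwise_append, List.pairwise_map] at h1
  rw [bottomRow, List.pairwise_map] at h2
  have hc := eq_blockCols (h1.1.and h2) h3 h4
  have ht := Letter.eq_blockTail h1.2.1
  generalize T.cols.count (twoBar, oneBar) = a, T.cols.count (two, oneBar) = c,
    T.cols.count (two, twoBar) = e, T.cols.count (one, twoBar) = d,
    T.cols.count (one, two) = b at hc
  generalize T.tail.count oneBar = p, T.tail.count twoBar = q, T.tail.count two = r,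
    T.tail.count one = s at ht
  obtain ⟨cols, tail⟩ := T
  dsimp only at *
  subst hc ht
  refine ⟨p, q, r, s, a, c, e, d, b, rfl, ?_, ?_, ?_, ?_, ?_⟩
  -- Two columns `22̄` split into `12̄, 21̄, 12̄, 21̄`, whose second row has a `1̄` before a `2̄`.
  · by_contra he
    obtain ⟨k, rfl⟩ : ∃ k, e = k + 2 := ⟨e - 2, by omega⟩
    have h6 := h5.2.1
    simp [bottomRow, split, blockCols, List.replicate_succ, splitCol, List.pairwise_append,
      show ¬oneBar ≤ twoBar by decide] at h6
  · have h6 := h1.2.2 two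
    by_contra! h7
    have := h6 (by simp [blockCols]; omega) one (by simp [blockTail]; omega)
    exact absurd this (by decide)
  · have h6 := h1.2.2 twoBar
    by_contra! h7
    by_cases hr : r = 0
    · have := h6 (by simp [blockCols]; omega) one (by simp [blockTail]; omega)
      exact absurd this (by decide)
    · have := h6 (by simp [blockCols]; omega) two (by simp [blockTail]; omega)
      exact absurd this (by decide)
  · rw [← hl1]
    simp [blockTail]
    omega
  · rw [← hl2]
    simp [blockCols]
    omega

/-! ### The embedding, block by block -/

/-- Columns whose first row is shifted one step to the right, with `x` put in front. -/
def shiftTop : Letter → List (Letter × Letter) → List (Letter × Letter)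
  | _, [] => []
  | x, c :: cs => (x, c.2) :: shiftTop c.1 cs

/-- The entry that `shiftTop` moves out of the columns. -/
def lastTop : Letter → List (Letter × Letter) → Letter
  | x, [] => x
  | _, c :: cs => lastTop c.1 cs

theorem zip_eq_shiftTop (x : Letter) (cs : List (Letter × Letter)) (t : List Letter) :
    (x :: (cs.map Prod.fst ++ t)).zip (cs.map Prod.snd) = shiftTop x cs := by
  induction cs generalizing x with
  | nil => simp [shiftTop]
  | cons c cs ih => simp [shiftTop, ← ih c.1]

theorem drop_eq_lastTop (x : Letter) (cs : List (Letter × Letter)) (t : List Letter) :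
    (x :: (cs.map Prod.fst ++ t)).drop (cs.map Prod.snd).length = lastTop x cs :: t := by
  induction cs generalizing x with
  | nil => simp [lastTop]
  | cons c cs ih => simpa [lastTop] using ih c.1

theorem embed_eq (T : Tableau) :
    embed T = ⟨(shiftTop one T.cols).map
        (fun c => if c = (one, oneBar) then (two, twoBar) else c),
      lastTop one T.cols :: (T.tail ++ [oneBar])⟩ := by
  simp only [embed, ofRows, topRow, bottomRow, List.append_assoc]
  rw [zip_eq_shiftTop, drop_eq_lastTop]

theorem shiftTop_append (x : Letter) (cs ds : List (Letter × Letter)) :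
    shiftTop x (cs ++ ds) = shiftTop x cs ++ shiftTop (lastTop x cs) ds := by
  induction cs generalizing x with
  | nil => rfl
  | cons c cs ih => simp [shiftTop, lastTop, ih]

theorem lastTop_append (x : Letter) (cs ds : List (Letter × Letter)) :
    lastTop x (cs ++ ds) = lastTop (lastTop x cs) ds := by
  induction cs generalizing x with
  | nil => rfl
  | cons c cs ih => simp [lastTop, ih]

theorem shiftTop_replicate (k : ℕ) (x y : Letter) :
    shiftTop x (List.replicate k (x, y)) = List.replicate k (x, y) := by
  induction k with
  | zero => rfl
  | succ k ih => simp [List.replicate_succ, shiftTop, ih]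

theorem lastTop_replicate (k : ℕ) (x y : Letter) :
    lastTop x (List.replicate k (x, y)) = x := by
  induction k with
  | zero => rfl
  | succ k ih => simp [List.replicate_succ, lastTop, ih]

theorem shiftTop_replicate_succ (k : ℕ) (x y z : Letter) :
    shiftTop z (List.replicate (k + 1) (x, y)) = (z, y) :: List.replicate k (x, y) := by
  rw [List.replicate_succ, shiftTop, shiftTop_replicate]

theorem lastTop_replicate_succ (k : ℕ) (x y z : Letter) :
    lastTop z (List.replicate (k + 1) (x, y)) = x := by
  rw [List.replicate_succ, lastTop, lastTop_replicate]

/-- The cases of the embedding are named after the letter pushed from the columns into the tail, and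
after the parity of `e`. A column `1, 1̄` to be replaced arises only for `e = 0`, when the shift
carries a `1` onto the first column with bottom entry `1̄`. -/
theorem embed_one (p q r s d b : ℕ) :
    embed (blockTableau p q r s 0 0 0 d b) = blockTableau (p + 1) q r (s + 1) 0 0 0 d b := by
  rw [embed_eq]
  simp [blockTableau, blockCols, blockTail, shiftTop_append, lastTop_append, shiftTop_replicate,
    lastTop_replicate, List.replicate_succ' (n := p), List.replicate_succ (n := s)]

theorem embed_two_odd (p q r c d b : ℕ) :
    embed (blockTableau p q r 0 0 c 1 d b) = blockTableau (p + 1) q (r + 1) 0 0 c 0 (d + 1) b := by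
  rw [embed_eq]
  simp [blockTableau, blockCols, blockTail, shiftTop_append, lastTop_append, shiftTop_replicate,
    lastTop_replicate, List.replicate_succ' (n := p), List.replicate_succ (n := r),
    List.replicate_succ' (n := d), shiftTop, lastTop]

theorem embed_two_even (p q r c d b : ℕ) :
    embed (blockTableau p q r 0 0 (c + 1) 0 d b) = blockTableau (p + 1) q (r + 1) 0 0 c 1 d b := by
  rw [embed_eq]
  simp [blockTableau, blockCols, blockTail, shiftTop_append, lastTop_append, shiftTop_replicate,
    lastTop_replicate, List.replicate_succ' (n := p), List.replicate_succ (n := r),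
    shiftTop_replicate_succ, lastTop_replicate_succ]

theorem embed_twoBar_odd (p q a c d b : ℕ) :
    embed (blockTableau p q 0 0 (a + 1) c 1 d b) =
      blockTableau (p + 1) (q + 1) 0 0 a (c + 1) 0 (d + 1) b := by
  rw [embed_eq]
  simp [blockTableau, blockCols, blockTail, shiftTop_append, lastTop_append, shiftTop_replicate,
    lastTop_replicate, List.replicate_succ' (n := p), List.replicate_succ (n := q),
    List.replicate_succ' (n := d), List.replicate_succ' (n := c), shiftTop, lastTop,
    shiftTop_replicate_succ, lastTop_replicate_succ]

theorem embed_twoBar_even (p q a c d b : ℕ) :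
    embed (blockTableau p q 0 0 (a + 1) c 0 d b) =
      blockTableau (p + 1) (q + 1) 0 0 a c 1 d b := by
  rw [embed_eq]
  -- The `1` lands on the first column `2̄1̄` if `c = 0`, and otherwise on the first column `21̄`.
  rcases c with _ | c
  · simp [blockTableau, blockCols, blockTail, shiftTop_append, lastTop_append, shiftTop_replicate,
      lastTop_replicate, List.replicate_succ' (n := p), List.replicate_succ (n := q),
      shiftTop_replicate_succ, lastTop_replicate_succ]
  · simp [blockTableau, blockCols, blockTail, shiftTop_append, lastTop_append, shiftTop_replicate,
      lastTop_replicate, List.replicate_succ' (n := p), List.replicate_succ (n := q),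
      shiftTop_replicate_succ, lastTop_replicate_succ]
    simp [List.replicate_succ']

/-- What the embedding does to the shape, to the weight and to `Z`. -/
theorem embed_spec {l1 l2 : ℕ} {T : Tableau} (hT : T ∈ crystal l1 l2) :
    embed T ∈ crystal (l1 + 2) l2 ∧ (embed T).wt1 = T.wt1 ∧ (embed T).wt2 = T.wt2 ∧
      Z (embed T) = Z T + 1 := by
  -- Bookkeeping common to the five cases, which differ only in the multiplicities and in the
  -- identity for `wordZ`.
  have key : ∀ {p q r s a c e d b p' q' r' s' a' c' e' d' b' : ℕ},
      embed (blockTableau p q r s a c e d b) = blockTableau p' q' r' s' a' c' e' d' b' →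
      e ≤ 1 → e' ≤ 1 → c' + e' = 0 ∨ s' = 0 → a' = 0 ∨ r' = 0 ∧ s' = 0 →
      p' + q' + r' + s' = p + q + r + s + 2 → a' + c' + e' + d' + b' = a + c + e + d + b →
      (s' + q' + (2 * d' + e') : ℤ) - (p' + r' + (2 * c' + e')) =
        (s + q + (2 * d + e) : ℤ) - (p + r + (2 * c + e)) →
      (r' - q' + b' - a' + c' - d' : ℤ) = r - q + b - a + c - d →
      wordZ (blockWord p' q' r' s' a' (2 * c' + e') (2 * d' + e') b') =
        wordZ (blockWord p q r s a (2 * c + e) (2 * d + e) b) + 1 →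
      embed (blockTableau p q r s a c e d b) ∈
          crystal (p + q + r + s + 2) (a + c + e + d + b) ∧
        (embed (blockTableau p q r s a c e d b)).wt1 = (blockTableau p q r s a c e d b).wt1 ∧
        (embed (blockTableau p q r s a c e d b)).wt2 = (blockTableau p q r s a c e d b).wt2 ∧
        Z (embed (blockTableau p q r s a c e d b)) = Z (blockTableau p q r s a c e d b) + 1 := by
    intro p q r s a c e d b p' q' r' s' a' c' e' d' b' hE he he' hs ha h1 h2 h3 h4 h5
    rw [hE, wt1_blockTableau, wt1_blockTableau, wt2_blockTableau, wt2_blockTableau, ← h1, ← h2]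
    refine ⟨blockTableau_mem_crystal he' hs ha, h3, h4, ?_⟩
    rw [wordZ, wordZ] at h5
    rw [Z, Z, word_blockTableau _ _ _ _ _ _ _ _ _ he, word_blockTableau _ _ _ _ _ _ _ _ _ he', h5]
  obtain ⟨p, q, r, s, a, c, e, d, b, rfl, he, hs, ha, rfl, rfl⟩ := exists_eq_blockTableau hT
  rcases a with _ | a
  · obtain rfl | rfl : e = 0 ∨ e = 1 := by omega
    · rcases c with _ | c
      · exact key (embed_one p q r s d b) he (by omega) (by omega) (by omega) (by omega)
          (by omega) (by push_cast; ring) (by push_cast; ring)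
          (wordZ_embed_one p q r s (2 * d + 0) b (by omega))
      · obtain rfl : s = 0 := by omega
        exact key (embed_two_even p q r c d b) he (by omega) (by omega) (by omega) (by omega)
          (by omega) (by push_cast; ring) (by push_cast; ring)
          (wordZ_embed_two p q r (2 * c + 1) (2 * d) b (by omega))
    · obtain rfl : s = 0 := by omega
      exact key (embed_two_odd p q r c d b) he (by omega) (by omega) (by omega) (by omega)
        (by omega) (by push_cast; ring) (by push_cast; ring)
        (wordZ_embed_two p q r (2 * c) (2 * d + 1) b (by omega))
  · obtain ⟨rfl, rfl⟩ : r = 0 ∧ s = 0 := by omega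
    obtain rfl | rfl : e = 0 ∨ e = 1 := by omega
    · exact key (embed_twoBar_even p q a c d b) he (by omega) (by omega) (by omega) (by omega)
        (by omega) (by push_cast; ring) (by push_cast; ring)
        (wordZ_embed_twoBar p q a (2 * c) (2 * d) b (by omega))
    · exact key (embed_twoBar_odd p q a c d b) he (by omega) (by omega) (by omega) (by omega)
        (by omega) (by push_cast; ring) (by push_cast; ring)
        (wordZ_embed_twoBar p q a (2 * c + 1) (2 * d + 1) b (by omega))

/-! ### Iterated embeddings and principal preatoms -/

theorem embed_iterate_spec {l1 l2 : ℕ} {T : Tableau} (hT : T ∈ crystal l1 l2) (k : ℕ) :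
    embed^[k] T ∈ crystal (l1 + 2 * k) l2 ∧ (embed^[k] T).wt1 = T.wt1 ∧
      (embed^[k] T).wt2 = T.wt2 ∧ Z (embed^[k] T) = Z T + k := by
  induction k with
  | zero => exact ⟨hT, rfl, rfl, rfl⟩
  | succ k ih =>
    obtain ⟨h1, h2, h3, h4⟩ := ih
    obtain ⟨i1, i2, i3, i4⟩ := embed_spec h1
    rw [Function.iterate_succ_apply']
    exact ⟨i1, i2.trans h2, i3.trans h3, by omega⟩

/-- A tableau of a principal preatom is not in the image of the embedding. -/
theorem embed_ne_of_mem_principalPreatom {l1 l2 : ℕ} {T U : Tableau}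
    (hT : T ∈ principalPreatom l1 l2) {k : ℕ} (hU : U ∈ crystal k l2) (hk : k + 2 = l1) :
    embed U ≠ T := by
  rintro rfl
  subst hk
  rw [principalPreatom, if_pos (by omega)] at hT
  exact hT.2 ⟨U, hU, rfl⟩

theorem Z_of_mem_principalPreatom {l1 l2 : ℕ} {T : Tableau} (hT : T ∈ principalPreatom l1 l2) :
    (Z T : ℚ) = l1 + l2 + T.wt1 + T.wt2 + max 0 ((|(T.wt1 : ℚ)| - l1) / 2) := by
  have hT' : T ∈ crystal l1 l2 := by
    unfold principalPreatom at hT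
    split_ifs at hT with h
    · exact hT.1
    · exact hT
  obtain ⟨p, q, r, s, a, c, e, d, b, rfl, he, hs, ha, rfl, rfl⟩ := exists_eq_blockTableau hT'
  have hne : ∀ {p' q' r' s' a' c' e' d' b' : ℕ}, e' ≤ 1 → c' + e' = 0 ∨ s' = 0 →
      a' = 0 ∨ r' = 0 ∧ s' = 0 → p' + q' + r' + s' + 2 = p + q + r + s →
      a' + c' + e' + d' + b' = a + c + e + d + b →
      embed (blockTableau p' q' r' s' a' c' e' d' b') ≠ blockTableau p q r s a c e d b := by
    intro p' q' r' s' a' c' e' d' b' he' hs' ha' h1 h2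
    refine embed_ne_of_mem_principalPreatom hT ?_ h1
    rw [← h2]
    exact blockTableau_mem_crystal he' hs' ha'
  -- Each excluded configuration would have an explicit preimage under the embedding, contradicting
  -- `hne`.
  have hc := cases_of_not_embed (p := p) (q := q) (r := r) (s := s) (a := a) (m := 2 * c + e)
    (n := 2 * d + e) (by omega) ha
    (by
      rintro ⟨hp, hs', rfl, hm⟩
      obtain ⟨rfl, rfl⟩ : c = 0 ∧ e = 0 := by omega
      obtain ⟨p, rfl⟩ := Nat.exists_eq_add_of_le' hp
      obtain ⟨s, rfl⟩ := Nat.exists_eq_add_of_le' hs'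
      exact hne (by omega) (by omega) (by omega) (by omega) (by omega) (embed_one p q r s d b))
    (by
      rintro ⟨hp, hr, hn, rfl, rfl⟩
      obtain ⟨p, rfl⟩ := Nat.exists_eq_add_of_le' hp
      obtain ⟨r, rfl⟩ := Nat.exists_eq_add_of_le' hr
      obtain rfl | rfl : e = 0 ∨ e = 1 := by omega
      · obtain ⟨d, rfl⟩ := Nat.exists_eq_add_of_le' (show 1 ≤ d by omega)
        exact hne (by omega) (by omega) (by omega) (by omega) (by omega)
          (embed_two_odd p q r c d b)
      · exact hne (by omega) (by omega) (by omega) (by omega) (by omega)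
          (embed_two_even p q r c d b))
    (by
      rintro ⟨hp, hq, hm, hn, rfl, rfl⟩
      obtain ⟨p, rfl⟩ := Nat.exists_eq_add_of_le' hp
      obtain ⟨q, rfl⟩ := Nat.exists_eq_add_of_le' hq
      obtain rfl | rfl : e = 0 ∨ e = 1 := by omega
      · obtain ⟨c, rfl⟩ := Nat.exists_eq_add_of_le' (show 1 ≤ c by omega)
        obtain ⟨d, rfl⟩ := Nat.exists_eq_add_of_le' (show 1 ≤ d by omega)
        exact hne (by omega) (by omega) (by omega) (by omega) (by omega)
          (embed_twoBar_odd p q a c d b)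
      · exact hne (by omega) (by omega) (by omega) (by omega) (by omega)
          (embed_twoBar_even p q a c d b))
  have hM := Int.toNat_of_nonneg (le_max_left 0
    (|(s + q + (2 * d + e : ℕ) : ℤ) - (p + r + (2 * c + e : ℕ))| - (p + q + r + s)))
  have hZ := wordZ_of_not_embed p q r s a (2 * c + e) (2 * d + e) b _ (by omega) hc hM
  rw [hM] at hZ
  have hZ' : (wordZ (blockWord p q r s a (2 * c + e) (2 * d + e) b) : ℤ) =
      Z (blockTableau p q r s a c e d b) := by
    rw [Z, word_blockTableau _ _ _ _ _ _ _ _ _ he, wordZ]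
  rw [hZ'] at hZ
  have hmax : max 0 ((|((blockTableau p q r s a c e d b).wt1 : ℚ)| - (p + q + r + s : ℕ)) / 2) =
      max 0 (|((blockTableau p q r s a c e d b).wt1 : ℚ)| - (p + q + r + s : ℕ)) / 2 := by
    rw [← max_div_div_right (by norm_num : (0 : ℚ) ≤ 2), zero_div]
  rw [hmax, wt1_blockTableau, wt2_blockTableau]
  have hZq := congrArg (Int.cast : ℤ → ℚ) hZ
  push_cast at hZq ⊢
  linarith

end C2

theorem mainTheorem7 (l1 l2 : ℕ) (T : C2.Tableau) (hT : T ∈ C2.crystal l1 l2)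
    (p : ℕ) (hp : p = C2.preatomicNumber l1 l2 T) :
    (C2.Z T : ℚ) =
      ((l1 : ℚ) - 2 * p) + l2 + T.wt1 + T.wt2
        + max 0 ((|(T.wt1 : ℚ)| - ((l1 : ℚ) - 2 * p)) / 2) + p := by
  obtain ⟨hle, U, hU, hUT⟩ := C2.mem_preatom hT
  rw [← hp] at hle hU hUT
  have hU' : U ∈ C2.crystal (l1 - 2 * p) l2 := by
    unfold C2.principalPreatom at hU
    split_ifs at hU with h
    · exact hU.1
    · exact hU
  obtain ⟨-, h1, h2, h3⟩ := C2.embed_iterate_spec hU' p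
  rw [hUT] at h1 h2 h3
  have hZ := C2.Z_of_mem_principalPreatom hU
  -- The shape `l1 - 2 * p` of the preimage is a truncated difference; `hle` makes it exact.
  push_cast [Nat.cast_sub hle] at hZ
  rw [h1, h2, h3, Nat.cast_add, hZ]
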